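/- Let $m_0,m$ be the numbers of phases in level $0$ and in each level $k\ge 1$, and let $$Q=\begin{pmatrix}B_1&B_0&&&\\ B_2&A_1&A_0&&\\ &A_2&A_1&A_0&\\ &&A_2&A_1&A_0\\ &&&\ddots&\ddots&\ddots\end{pmatrix}$$ be the infinitesimal generator of a continuous-time level-independent QBD process, where $B_1$ is $m_0\times m_0$, $B_0$ is $m_0\times m$, $B_2$ is $m\times m_0$ and $A_0,A_1,A_2$ are $m\times m$; that is, the off-diagonal entries of $Q$ are nonnegative and its row sums are zero. Assume that the process is irreducible and positive recurrent, with stationary probability vector $x=(x_0,x_1,x_2,\ldots)$ (so $x\ge 0$, $xQ=0$, and the entries of $x$ sum to $1$), and let $\pi_n=\sum_{j=n}^{\infty}x_j$ for $n\ge 1$. Define $\Psi_0=A_0+A_1$ and, for $k\ge 1$, $$\Psi_k=A_1+A_2(-\Psi_{k-1}^{-1})A_0,\qquad \mathbf R_k=A_2(-\Psi_{k-1}^{-1}),\qquad \mathbf G_{k-1}=(-\Psi_{k-1}^{-1})A_0,$$ $$X_k^{(l)}=\mathbf R_l\mathbf R_{l-1}\cdots\mathbf R_{l-k+1}\ (l\ge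 k\ge 1),\qquad Y_k^{(l)}=\mathbf G_l\mathbf G_{l+1}\cdots\mathbf G_{l+k-1}\ (k\ge 1,\ l\ge 0).$$ Then every $\Psi_k$, $k\ge 0$, is invertible (so that these definitions make sense), the matrix series below converge, and $$\pi_1=x_0B_0\Bigl[(-\Psi_0^{-1})+\sum_{k=1}^{\infty}Y_k^{(0)}(-\Psi_k^{-1})X_k^{(k)}\Bigr],$$ and for every $n\ge 2$ $$\pi_n=x_0B_0\Bigl[Y_{n-1}^{(0)}(-\Psi_{n-1}^{-1})+\sum_{k=n}^{\infty}Y_k^{(0)}(-\Psi_k^{-1})X_{k-(n-1)}^{(k)}\Bigr].$$ -/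

import Mathlib

namespace QBD

open Matrix

/-- State space of a quasi-birth-death process with `m₀` phases in level `0` and `m` phases in
each level `≥ 1`: `Sum.inl i` is phase `i` of level `0`, and `Sum.inr (k, i)` is phase `i` of
level `k + 1`. -/
abbrev State (m₀ m : ℕ) : Type := Fin m₀ ⊕ (ℕ × Fin m)

/-- The block tridiagonal matrix with first block row `(B₁, B₀)`, second block row
`(B₂, A₁, A₀)` and all later block rows `(A₂, A₁, A₀)`. -/
def blockMatrix {m₀ m : ℕ} (B₁ : Matrix (Fin m₀) (Fin m₀) ℝ) (B₀ : Matrix (Fin m₀) (Fin m) ℝ)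
    (B₂ : Matrix (Fin m) (Fin m₀) ℝ) (A₀ A₁ A₂ : Matrix (Fin m) (Fin m) ℝ) :
    Matrix (State m₀ m) (State m₀ m) ℝ
  | Sum.inl i, Sum.inl j => B₁ i j
  | Sum.inl i, Sum.inr (l, j) => if l = 0 then B₀ i j else 0
  | Sum.inr (k, i), Sum.inl j => if k = 0 then B₂ i j else 0
  | Sum.inr (k, i), Sum.inr (l, j) =>
      if l = k + 1 then A₀ i j else if l = k then A₁ i j else if k = l + 1 then A₂ i j else 0

/-- `Q` is the (conservative) infinitesimal generator of a continuous-time Markov chain. -/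
structure IsGenerator {S : Type*} (Q : Matrix S S ℝ) : Prop where
  offDiag_nonneg : ∀ i j, i ≠ j → 0 ≤ Q i j
  rowSum_eq_zero : ∀ i, HasSum (fun j => Q i j) 0

/-- Irreducibility: every state leads to every other one through transitions of positive rate. -/
def IsIrreducible {S : Type*} (Q : Matrix S S ℝ) : Prop :=
  ∀ i j, Relation.ReflTransGen (fun a b => a ≠ b ∧ 0 < Q a b) i j

/-- `x` is a stationary probability vector of the generator `Q`: `x ≥ 0`, `x e = 1`, `x Q = 0`. -/
structure IsStationary {S : Type*} (Q : Matrix S S ℝ) (x : S → ℝ) : Prop where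
  nonneg : ∀ i, 0 ≤ x i
  hasSum_one : HasSum x 1
  balance : ∀ j, HasSum (fun i => x i * Q i j) 0

/-- The part `x₀` of the vector `x` at level `0`. -/
def level₀ {m₀ m : ℕ} (x : State m₀ m → ℝ) : Fin m₀ → ℝ := fun i => x (Sum.inl i)

/-- The part `x_k` of the vector `x` at level `k ≥ 1` (the value at `k = 0` is a dummy). -/
def level {m₀ m : ℕ} (x : State m₀ m → ℝ) : ℕ → Fin m → ℝ
  | 0 => 0
  | k + 1 => fun i => x (Sum.inr (k, i))

/-- The tail probability vector `π_n = ∑_{j ≥ n} x_j`, for `n ≥ 1`. -/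
noncomputable def tail {m₀ m : ℕ} (x : State m₀ m → ℝ) (n : ℕ) : Fin m → ℝ :=
  fun i => ∑' j : ℕ, level x (n + j) i

section LU

variable {m : ℕ} (A₀ A₁ A₂ : Matrix (Fin m) (Fin m) ℝ)

/-- `Ψ₀ = A₀ + A₁` and `Ψ_k = A₁ + A₂ (-Ψ_{k-1}⁻¹) A₀` for `k ≥ 1`. -/
noncomputable def Psi : ℕ → Matrix (Fin m) (Fin m) ℝ
  | 0 => A₀ + A₁
  | k + 1 => A₁ + A₂ * (-(Psi k)⁻¹) * A₀

/-- `R_k = A₂ (-Ψ_{k-1}⁻¹)` for `k ≥ 1` (the value at `k = 0` is a dummy). -/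
noncomputable def R : ℕ → Matrix (Fin m) (Fin m) ℝ
  | 0 => 0
  | k + 1 => A₂ * (-(Psi A₀ A₁ A₂ k)⁻¹)

/-- `G_k = (-Ψ_k⁻¹) A₀` for `k ≥ 0`. -/
noncomputable def G (k : ℕ) : Matrix (Fin m) (Fin m) ℝ :=
  (-(Psi A₀ A₁ A₂ k)⁻¹) * A₀

/-- `X_k^{(l)} = R_l R_{l-1} ⋯ R_{l-k+1}`, for `l ≥ k ≥ 1`. -/
noncomputable def X (l k : ℕ) : Matrix (Fin m) (Fin m) ℝ :=
  ((List.range k).map (fun i => R A₀ A₁ A₂ (l - i))).prod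

/-- `Y_k^{(l)} = G_l G_{l+1} ⋯ G_{l+k-1}`, for `k ≥ 1`, `l ≥ 0`. -/
noncomputable def Y (l k : ℕ) : Matrix (Fin m) (Fin m) ℝ :=
  ((List.range k).map (fun i => G A₀ A₁ A₂ (l + i))).prod

end LU

end QBD

namespace QBD

open Matrix Filter Topology

/-! ### Nonnegative row vectors and sign patterns of matrices -/

section Nonneg

variable {ι : Type*} [Fintype ι]

/-! Put `p n = π_{n+1}`. The balance equations and `p n → 0` give `p M = (-x₀B₀, 0, 0, …)`, where
`M` is block tridiagonal with first block row `(A₀ + A₁, A₀)` and later rows `(A₂, A₁, A₀)`. The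
`Ψ_k` are the pivots of block elimination in `M` from the lowest level upwards, and the series is
the corresponding back substitution started at infinity. It remains to justify the pivots, the
convergence, and the choice of solution.

The main tool is a minimum principle (`nonneg_of_leftMul_nonpos`): if `z M ≤ 0` on the levels up to
`K` and `z ≥ 0` just above them, then `z ≥ 0` on them. The comparison vector is `p` itself, which is
positive with `p M ≤ 0`; irreducibility excludes a touching point. Applied to a vector at level `K`
continued downwards by the `R_k`, it makes `Ψ_K` injective and `-Ψ_K⁻¹` nonnegative. Applied to a
supersolution minus the partial sums, which solve truncated systems, it bounds the series. The
vector `p` bounds only the product with `x₀B₀`; `exists_supersolution` supplies a bound for every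
row, so the matrix series converges.

The resulting vector `v` solves the same system and `0 ≤ v ≤ p`, so `p - v` is a homogeneous
solution tending to zero. It vanishes by `eq_zero_of_leftMul_eq_zero`, which compares the absolute
values of its increments with the chain killed on entering level `0`. -/

theorem vecMul_nonneg {κ : Type*} {u : ι → ℝ} {T : Matrix ι κ ℝ} (hu : 0 ≤ u)
    (hT : ∀ i j, 0 ≤ T i j) : 0 ≤ u ᵥ* T := fun j =>
  Finset.sum_nonneg fun i _ => mul_nonneg (hu i) (hT i j)

theorem mul_entries_nonneg {S T : Matrix ι ι ℝ} (hS : ∀ i j, 0 ≤ S i j) (hT : ∀ i j, 0 ≤ T i j)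
    (i j : ι) : 0 ≤ (S * T) i j :=
  Finset.sum_nonneg fun k _ => mul_nonneg (hS i k) (hT k j)

theorem list_prod_entries_nonneg [DecidableEq ι] {l : List (Matrix ι ι ℝ)}
    (h : ∀ T ∈ l, ∀ i j, 0 ≤ T i j) (i j : ι) : 0 ≤ l.prod i j := by
  induction l generalizing i j with
  | nil => simp only [List.prod_nil, Matrix.one_apply]; split_ifs <;> norm_num
  | cons T l ih =>
    rw [List.prod_cons]
    exact mul_entries_nonneg (h T (by simp))
      (fun i j => ih (fun S hS => h S (by simp [hS])) i j) i j

/-- At a zero of `u ≥ 0`, only the entries of `T` off the diagonal matter. -/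
theorem vecMul_apply_nonneg_of_eq_zero {u : ι → ℝ} {T : Matrix ι ι ℝ} {j : ι} (hu : 0 ≤ u)
    (huj : u j = 0) (hT : ∀ i, i ≠ j → 0 ≤ T i j) : 0 ≤ (u ᵥ* T) j :=
  Finset.sum_nonneg fun i _ => by
    by_cases hij : i = j
    · subst hij; simp [huj]
    · exact mul_nonneg (hu i) (hT i hij)

theorem eq_zero_of_vecMul_apply_nonpos {u : ι → ℝ} {T : Matrix ι ι ℝ} {j : ι} (hu : 0 ≤ u)
    (huj : u j = 0) (hT : ∀ i, i ≠ j → 0 ≤ T i j) (h : (u ᵥ* T) j ≤ 0) {i : ι}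
    (hij : 0 < T i j) : u i = 0 := by
  have hterm : ∀ i ∈ Finset.univ, 0 ≤ u i * T i j := fun i _ => by
    by_cases hij : i = j
    · subst hij; simp [huj]
    · exact mul_nonneg (hu i) (hT i hij)
  have h0 : ∑ i, u i * T i j = 0 := le_antisymm h (Finset.sum_nonneg hterm)
  have := (Finset.sum_eq_zero_iff_of_nonneg hterm).1 h0 i (Finset.mem_univ i)
  exact (mul_eq_zero.1 this).resolve_right hij.ne'

theorem eq_zero_of_vecMul_apply_nonpos_of_nonneg {u : ι → ℝ} {T : Matrix ι ι ℝ} {j : ι}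
    (hu : 0 ≤ u) (hT : ∀ i j, 0 ≤ T i j) (h : (u ᵥ* T) j ≤ 0) {i : ι} (hij : 0 < T i j) :
    u i = 0 := by
  have hterm : ∀ i ∈ Finset.univ, 0 ≤ u i * T i j := fun i _ => mul_nonneg (hu i) (hT i j)
  have h0 : ∑ i, u i * T i j = 0 := le_antisymm h (Finset.sum_nonneg hterm)
  have := (Finset.sum_eq_zero_iff_of_nonneg hterm).1 h0 i (Finset.mem_univ i)
  exact (mul_eq_zero.1 this).resolve_right hij.ne'

end Nonneg

/-! ### Block entries and row sums of the generator -/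

section Generator

variable {m₀ m : ℕ} {B₁ : Matrix (Fin m₀) (Fin m₀) ℝ} {B₀ : Matrix (Fin m₀) (Fin m) ℝ}
  {B₂ : Matrix (Fin m) (Fin m₀) ℝ} {A₀ A₁ A₂ : Matrix (Fin m) (Fin m) ℝ}

theorem IsGenerator.A₀_nonneg (hgen : IsGenerator (blockMatrix B₁ B₀ B₂ A₀ A₁ A₂)) (i j : Fin m) :
    0 ≤ A₀ i j := by
  simpa [blockMatrix] using hgen.offDiag_nonneg (Sum.inr (0, i)) (Sum.inr (1, j)) (by simp)

theorem IsGenerator.A₁_nonneg (hgen : IsGenerator (blockMatrix B₁ B₀ B₂ A₀ A₁ A₂)) {i j : Fin m}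
    (hij : i ≠ j) : 0 ≤ A₁ i j := by
  simpa [blockMatrix] using hgen.offDiag_nonneg (Sum.inr (0, i)) (Sum.inr (0, j)) (by simpa)

theorem IsGenerator.A₂_nonneg (hgen : IsGenerator (blockMatrix B₁ B₀ B₂ A₀ A₁ A₂)) (i j : Fin m) :
    0 ≤ A₂ i j := by
  simpa [blockMatrix] using hgen.offDiag_nonneg (Sum.inr (1, i)) (Sum.inr (0, j)) (by simp)

theorem IsGenerator.B₀_nonneg (hgen : IsGenerator (blockMatrix B₁ B₀ B₂ A₀ A₁ A₂)) (i : Fin m₀)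
    (j : Fin m) : 0 ≤ B₀ i j := by
  simpa [blockMatrix] using hgen.offDiag_nonneg (Sum.inl i) (Sum.inr (0, j)) (by simp)

theorem IsGenerator.B₂_nonneg (hgen : IsGenerator (blockMatrix B₁ B₀ B₂ A₀ A₁ A₂)) (i : Fin m)
    (j : Fin m₀) : 0 ≤ B₂ i j := by
  simpa [blockMatrix] using hgen.offDiag_nonneg (Sum.inr (0, i)) (Sum.inl j) (by simp)

theorem blockMatrix_inr_pos {k l : ℕ} {i j : Fin m}
    (h : 0 < blockMatrix B₁ B₀ B₂ A₀ A₁ A₂ (Sum.inr (k, i)) (Sum.inr (l, j))) :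
    (l = k + 1 ∧ 0 < A₀ i j) ∨ (l = k ∧ 0 < A₁ i j) ∨ (k = l + 1 ∧ 0 < A₂ i j) := by
  rw [blockMatrix] at h
  split_ifs at h with h1 h2 h3
  · exact Or.inl ⟨h1, h⟩
  · exact Or.inr (Or.inl ⟨h2, h⟩)
  · exact Or.inr (Or.inr ⟨h3, h⟩)
  · exact absurd h (lt_irrefl _)

theorem hasSum_ite_level (n : ℕ) (g : Fin m → ℝ) :
    HasSum (fun a : ℕ × Fin m => if a.1 = n then g a.2 else 0) (∑ i, g i) := by
  have h := hasSum_sum_of_ne_finset_zero (f := fun a : ℕ × Fin m => if a.1 = n then g a.2 else 0)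
    (s := {n} ×ˢ Finset.univ) (L := SummationFilter.unconditional _) (fun b hb => by
      have : b.1 ≠ n := fun h => hb
        (Finset.mem_product.2 ⟨Finset.mem_singleton.2 h, Finset.mem_univ _⟩)
      simp [this])
  simpa [Finset.sum_product] using h

theorem IsGenerator.rowSum_level_one
    (hgen : IsGenerator (blockMatrix B₁ B₀ B₂ A₀ A₁ A₂)) (i : Fin m) :
    ∑ j, B₂ i j + (∑ j, A₀ i j + ∑ j, A₁ i j) = 0 := by
  refine HasSum.unique ?_ (hgen.rowSum_eq_zero (Sum.inr (0, i)))
  refine HasSum.sum (hasSum_fintype (B₂ i)) ?_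
  convert (hasSum_ite_level 1 (A₀ i)).add (hasSum_ite_level 0 (A₁ i)) using 1
  funext ⟨k, j⟩
  simp only [Function.comp, blockMatrix]
  split_ifs <;> first | omega | simp_all

theorem IsGenerator.rowSum_level_two
    (hgen : IsGenerator (blockMatrix B₁ B₀ B₂ A₀ A₁ A₂)) (i : Fin m) :
    ∑ j, A₀ i j + ∑ j, A₁ i j + ∑ j, A₂ i j = 0 := by
  rw [← zero_add (_ + _ + _)]
  refine HasSum.unique ?_ (hgen.rowSum_eq_zero (Sum.inr (1, i)))
  refine HasSum.sum ?_ ?_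
  · convert hasSum_zero using 1
    funext j
    simp [blockMatrix]
  · convert ((hasSum_ite_level 2 (A₀ i)).add (hasSum_ite_level 1 (A₁ i))).add
      (hasSum_ite_level 0 (A₂ i)) using 1
    funext ⟨k, j⟩
    simp only [Function.comp, blockMatrix]
    split_ifs <;> first | omega | simp

/-- The rows of the first two levels above `0` share `A₀` and `A₁`, so their downward rates must
agree. This lets `A₂` measure the exit rate into level `0`. -/
theorem IsGenerator.sum_B₂_eq_sum_A₂
    (hgen : IsGenerator (blockMatrix B₁ B₀ B₂ A₀ A₁ A₂)) (i : Fin m) :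
    ∑ j, B₂ i j = ∑ j, A₂ i j := by
  linarith [hgen.rowSum_level_one i, hgen.rowSum_level_two i]

theorem IsGenerator.A₁_mulVec_one (hgen : IsGenerator (blockMatrix B₁ B₀ B₂ A₀ A₁ A₂)) :
    A₁ *ᵥ 1 = -(A₀ *ᵥ 1) - A₂ *ᵥ 1 := by
  funext i
  simp only [Matrix.mulVec, dotProduct_one, Pi.sub_apply, Pi.neg_apply]
  linarith [hgen.rowSum_level_two i]

/-- If there are states above level `0`, then level `0` is not empty. -/
theorem nonempty_level₀ (hgen : IsGenerator (blockMatrix B₁ B₀ B₂ A₀ A₁ A₂))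
    (hirr : IsIrreducible (blockMatrix B₁ B₀ B₂ A₀ A₁ A₂)) (i : Fin m) : Nonempty (Fin m₀) := by
  by_contra hne
  rw [not_nonempty_iff] at hne
  have hA₂ : ∀ i j, A₂ i j = 0 := fun i j => by
    have h := hgen.sum_B₂_eq_sum_A₂ i
    rw [Finset.univ_eq_empty, Finset.sum_empty] at h
    exact (Finset.sum_eq_zero_iff_of_nonneg fun j _ => hgen.A₂_nonneg i j).1 h.symm j
      (Finset.mem_univ j)
  -- With `A₂ = 0` no path descends, so the level with index `0` cannot be reached from index `1`.
  have key : ∀ b : State m₀ m, Relation.ReflTransGen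
      (fun a b => a ≠ b ∧ 0 < blockMatrix B₁ B₀ B₂ A₀ A₁ A₂ a b) (Sum.inr (1, i)) b →
      ∃ k j, b = Sum.inr (k + 1, j) := by
    intro b hb
    induction hb with
    | refl => exact ⟨0, i, rfl⟩
    | @tail b c _ hbc ih =>
      obtain ⟨k, j, rfl⟩ := ih
      rcases c with c | ⟨l, c⟩
      · exact hne.elim c
      · rcases blockMatrix_inr_pos hbc.2 with ⟨h, -⟩ | ⟨h, -⟩ | ⟨-, h⟩
        · exact ⟨k + 1, c, by rw [h]⟩
        · exact ⟨k, c, by rw [h]⟩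
        · exact absurd (hA₂ j c) h.ne'
  obtain ⟨k, j, h⟩ := key _ (hirr (Sum.inr (1, i)) (Sum.inr (0, i)))
  simp at h

end Generator

/-! ### Stationary vector and its tails -/

section Stationary

/-- A stationary probability vector of an irreducible generator is positive. -/
theorem IsStationary.pos {S : Type*} {Q : Matrix S S ℝ} {x : S → ℝ} (hgen : IsGenerator Q)
    (hirr : IsIrreducible Q) (hx : IsStationary Q x) (j : S) : 0 < x j := by
  refine lt_of_le_of_ne (hx.nonneg j) fun hj => ?_
  have step : ∀ a b, a ≠ b → 0 < Q a b → x b = 0 → x a = 0 := by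
    intro a b _ hab hb
    have hterm : ∀ i, 0 ≤ x i * Q i b := fun i => by
      by_cases hib : i = b
      · subst hib; simp [hb]
      · exact mul_nonneg (hx.nonneg i) (hgen.offDiag_nonneg i b hib)
    have h0 := congrFun ((hasSum_zero_iff_of_nonneg hterm).1 (hx.balance b)) a
    exact (mul_eq_zero.1 h0).resolve_right hab.ne'
  have hall : ∀ i, x i = 0 := fun i => by
    refine Relation.ReflTransGen.head_induction_on (motive := fun a _ => x a = 0) (hirr i j)
      hj.symm ?_
    intro a c hac _ ih
    exact step a c hac.1 hac.2 ih
  have h1 := hx.hasSum_one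
  rw [show x = fun _ => 0 from funext hall] at h1
  exact one_ne_zero (h1.unique hasSum_zero)

variable {m₀ m : ℕ} {B₁ : Matrix (Fin m₀) (Fin m₀) ℝ} {B₀ : Matrix (Fin m₀) (Fin m) ℝ}
  {B₂ : Matrix (Fin m) (Fin m₀) ℝ} {A₀ A₁ A₂ : Matrix (Fin m) (Fin m) ℝ}
  {x : State m₀ m → ℝ}

theorem IsStationary.balance_level_one
    (hx : IsStationary (blockMatrix B₁ B₀ B₂ A₀ A₁ A₂) x) :
    level₀ x ᵥ* B₀ + (level x 1 ᵥ* A₁ + level x 2 ᵥ* A₂) = 0 := by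
  funext j
  refine HasSum.unique ?_ (hx.balance (Sum.inr (0, j)))
  refine HasSum.sum ?_ ?_
  · change HasSum _ (∑ i, level₀ x i * B₀ i j)
    convert hasSum_fintype (fun i => level₀ x i * B₀ i j) using 1
    funext i
    simp [blockMatrix, level₀]
  · change HasSum _ (∑ i, level x 1 i * A₁ i j + ∑ i, level x 2 i * A₂ i j)
    convert (hasSum_ite_level 0 (fun i => level x 1 i * A₁ i j)).add
      (hasSum_ite_level 1 (fun i => level x 2 i * A₂ i j)) using 1
    funext ⟨k, i⟩
    simp only [Function.comp, blockMatrix]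
    split_ifs <;> first | omega | (exfalso; assumption) | (subst_vars; simp [level])

theorem IsStationary.balance_level
    (hx : IsStationary (blockMatrix B₁ B₀ B₂ A₀ A₁ A₂) x) (n : ℕ) :
    level x (n + 1) ᵥ* A₀ + level x (n + 2) ᵥ* A₁ + level x (n + 3) ᵥ* A₂ = 0 := by
  funext j
  rw [← zero_add (_ + _ + _), Pi.add_apply]
  refine HasSum.unique ?_ (hx.balance (Sum.inr (n + 1, j)))
  refine HasSum.sum ?_ ?_
  · change HasSum _ (0 : ℝ)
    convert hasSum_zero using 1
    funext i
    simp [blockMatrix]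
  · change HasSum _ (∑ i, level x (n + 1) i * A₀ i j + ∑ i, level x (n + 2) i * A₁ i j +
      ∑ i, level x (n + 3) i * A₂ i j)
    convert ((hasSum_ite_level n (fun i => level x (n + 1) i * A₀ i j)).add
      (hasSum_ite_level (n + 1) (fun i => level x (n + 2) i * A₁ i j))).add
      (hasSum_ite_level (n + 2) (fun i => level x (n + 3) i * A₂ i j)) using 1
    funext ⟨k, i⟩
    simp only [Function.comp, blockMatrix]
    split_ifs <;> first | omega | (subst_vars; simp [level])

theorem IsStationary.summable_level {Q : Matrix (State m₀ m) (State m₀ m) ℝ}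
    (hx : IsStationary Q x) (i : Fin m) : Summable fun k => level x k i := by
  rw [← summable_nat_add_iff 1]
  exact hx.hasSum_one.summable.comp_injective (i := fun k : ℕ => Sum.inr (k, i))
    (fun a b h => by simpa using h)

theorem IsStationary.tail_eq {Q : Matrix (State m₀ m) (State m₀ m) ℝ}
    (hx : IsStationary Q x) (n : ℕ) : tail x n = level x n + tail x (n + 1) := by
  funext i
  have hs : Summable fun j => level x (n + j) i := by
    simpa only [add_comm n] using (summable_nat_add_iff n).2 (hx.summable_level i)
  simp only [tail, Pi.add_apply]
  rw [hs.tsum_eq_zero_add]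
  simp only [add_zero, add_assoc, add_comm 1]

theorem tendsto_tail (x : State m₀ m → ℝ) : Tendsto (tail x) atTop (𝓝 0) := by
  rw [tendsto_pi_nhds]
  intro i
  simpa only [tail, add_comm, Pi.zero_apply] using tendsto_sum_nat_add fun k => level x k i

theorem IsStationary.tail_pos {Q : Matrix (State m₀ m) (State m₀ m) ℝ} (hgen : IsGenerator Q)
    (hirr : IsIrreducible Q) (hx : IsStationary Q x) (n : ℕ) (i : Fin m) :
    0 < tail x (n + 1) i := by
  have hs : Summable fun j => level x (n + 1 + j) i := by
    simpa only [add_comm (n + 1)] using (summable_nat_add_iff (n + 1)).2 (hx.summable_level i)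
  have hpos : ∀ k, 0 < level x (k + 1) i := fun k => hx.pos hgen hirr _
  refine hs.tsum_pos (fun j => ?_) 0 (hpos n)
  rw [show n + 1 + j = n + j + 1 by omega]
  exact (hpos _).le

end Stationary

/-! ### The linear system for the tails -/

section LeftMul

variable {m : ℕ}

/-- The product of the row vector `(z₀, z₁, …)` with the block tridiagonal matrix with first block
row `(A₀ + A₁, A₀)` and all later block rows `(A₂, A₁, A₀)`; the tail probabilities solve a linear
system with this matrix. -/
def leftMul (A₀ A₁ A₂ : Matrix (Fin m) (Fin m) ℝ) (z : ℕ → Fin m → ℝ) : ℕ → Fin m → ℝ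
  | 0 => z 0 ᵥ* (A₀ + A₁) + z 1 ᵥ* A₂
  | n + 1 => z n ᵥ* A₀ + z (n + 1) ᵥ* A₁ + z (n + 2) ᵥ* A₂

theorem leftMul_add (A₀ A₁ A₂ : Matrix (Fin m) (Fin m) ℝ) (z w : ℕ → Fin m → ℝ) (n : ℕ) :
    leftMul A₀ A₁ A₂ (z + w) n = leftMul A₀ A₁ A₂ z n + leftMul A₀ A₁ A₂ w n := by
  cases n <;> simp only [leftMul, Pi.add_apply, Matrix.add_vecMul] <;> abel

theorem leftMul_smul (A₀ A₁ A₂ : Matrix (Fin m) (Fin m) ℝ) (c : ℝ) (z : ℕ → Fin m → ℝ) (n : ℕ) :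
    leftMul A₀ A₁ A₂ (c • z) n = c • leftMul A₀ A₁ A₂ z n := by
  cases n <;> simp only [leftMul, Pi.smul_apply, Matrix.smul_vecMul, smul_add]

theorem leftMul_sub (A₀ A₁ A₂ : Matrix (Fin m) (Fin m) ℝ) (z w : ℕ → Fin m → ℝ) (n : ℕ) :
    leftMul A₀ A₁ A₂ (z - w) n = leftMul A₀ A₁ A₂ z n - leftMul A₀ A₁ A₂ w n := by
  cases n <;> simp only [leftMul, Pi.sub_apply, Matrix.sub_vecMul] <;> abel

theorem tendsto_vecMul {z : ℕ → Fin m → ℝ} (hz : Tendsto z atTop (𝓝 0))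
    (T : Matrix (Fin m) (Fin m) ℝ) : Tendsto (fun n => z n ᵥ* T) atTop (𝓝 0) := by
  have hc : Continuous fun v : Fin m → ℝ => v ᵥ* T :=
    Continuous.matrix_vecMul continuous_id continuous_const
  simpa [Function.comp_def] using (hc.tendsto 0).comp hz

theorem tendsto_leftMul (A₀ A₁ A₂ : Matrix (Fin m) (Fin m) ℝ) {z : ℕ → Fin m → ℝ}
    (hz : Tendsto z atTop (𝓝 0)) : Tendsto (leftMul A₀ A₁ A₂ z) atTop (𝓝 0) := by
  rw [← tendsto_add_atTop_iff_nat 1]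
  have h1 := (tendsto_add_atTop_iff_nat 1).2 hz
  have h2 := (tendsto_add_atTop_iff_nat 2).2 hz
  simpa [leftMul] using ((tendsto_vecMul hz A₀).add (tendsto_vecMul h1 A₁)).add (tendsto_vecMul h2 A₂)

variable {m₀ : ℕ} {B₁ : Matrix (Fin m₀) (Fin m₀) ℝ} {B₀ : Matrix (Fin m₀) (Fin m) ℝ}
  {B₂ : Matrix (Fin m) (Fin m₀) ℝ} {A₀ A₁ A₂ : Matrix (Fin m) (Fin m) ℝ}
  {x : State m₀ m → ℝ}

/-- Consecutive components differ by a balance equation, so they are all equal; they also tend to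
zero along with the tails. -/
theorem IsStationary.leftMul_tail_succ (hx : IsStationary (blockMatrix B₁ B₀ B₂ A₀ A₁ A₂) x)
    (n : ℕ) : leftMul A₀ A₁ A₂ (fun k => tail x (k + 1)) (n + 1) = 0 := by
  have hstep : ∀ n, leftMul A₀ A₁ A₂ (fun k => tail x (k + 1)) (n + 1) =
      leftMul A₀ A₁ A₂ (fun k => tail x (k + 1)) (n + 2) := fun n => by
    have hb := hx.balance_level n
    simp only [leftMul]
    rw [hx.tail_eq (n + 1), hx.tail_eq (n + 1 + 1), hx.tail_eq (n + 2 + 1)]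
    simp only [Matrix.add_vecMul] at hb ⊢
    linear_combination hb
  have hconst : ∀ k, leftMul A₀ A₁ A₂ (fun k => tail x (k + 1)) (k + (n + 1)) =
      leftMul A₀ A₁ A₂ (fun k => tail x (k + 1)) (n + 1) := fun k => by
    induction k with
    | zero => rw [zero_add]
    | succ k ih => rw [← ih, show k + 1 + (n + 1) = (k + n) + 2 by omega, ← hstep]; rfl
  have ht := tendsto_leftMul A₀ A₁ A₂ ((tendsto_add_atTop_iff_nat 1).2 (tendsto_tail x))
  have ht' := (tendsto_add_atTop_iff_nat (n + 1)).2 ht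
  simp only [hconst] at ht'
  exact tendsto_nhds_unique tendsto_const_nhds ht'

theorem IsStationary.leftMul_tail_zero (hx : IsStationary (blockMatrix B₁ B₀ B₂ A₀ A₁ A₂) x) :
    leftMul A₀ A₁ A₂ (fun k => tail x (k + 1)) 0 = -(level₀ x ᵥ* B₀) := by
  have h1 := hx.leftMul_tail_succ 0
  have hb := hx.balance_level_one
  simp only [leftMul, Matrix.vecMul_add] at h1 ⊢
  simp only [zero_add, Nat.reduceAdd] at h1 ⊢
  have e1 := congrArg (· ᵥ* A₁) (hx.tail_eq 1)
  have e2 := congrArg (· ᵥ* A₂) (hx.tail_eq 2)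
  simp only [Matrix.add_vecMul, Nat.reduceAdd] at e1 e2
  linear_combination h1 + hb + e1 + e2

theorem IsStationary.entry_nonneg (hgen : IsGenerator (blockMatrix B₁ B₀ B₂ A₀ A₁ A₂))
    (hx : IsStationary (blockMatrix B₁ B₀ B₂ A₀ A₁ A₂) x) : 0 ≤ level₀ x ᵥ* B₀ :=
  vecMul_nonneg (fun _ => hx.nonneg _) hgen.B₀_nonneg

theorem IsStationary.entry_pos (hgen : IsGenerator (blockMatrix B₁ B₀ B₂ A₀ A₁ A₂))
    (hirr : IsIrreducible (blockMatrix B₁ B₀ B₂ A₀ A₁ A₂))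
    (hx : IsStationary (blockMatrix B₁ B₀ B₂ A₀ A₁ A₂) x) {i : Fin m₀} {j : Fin m}
    (hij : 0 < B₀ i j) : 0 < (level₀ x ᵥ* B₀) j :=
  Finset.sum_pos' (fun k _ => mul_nonneg (hx.nonneg _) (hgen.B₀_nonneg k j))
    ⟨i, Finset.mem_univ i, mul_pos (hx.pos hgen hirr _) hij⟩

/-! ### Minimum principle and uniqueness -/

theorem leftMul_tail_le_zero (hgen : IsGenerator (blockMatrix B₁ B₀ B₂ A₀ A₁ A₂))
    (hx : IsStationary (blockMatrix B₁ B₀ B₂ A₀ A₁ A₂) x) (n : ℕ) :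
    leftMul A₀ A₁ A₂ (fun k => tail x (k + 1)) n ≤ 0 := by
  cases n with
  | zero =>
    rw [hx.leftMul_tail_zero]
    exact neg_nonpos.2 (hx.entry_nonneg hgen)
  | succ n => exact (hx.leftMul_tail_succ n).le

/-- At a zero of a nonnegative vector `u` whose product is nonpositive, the product vanishes and
so does `u` at every predecessor. -/
theorem leftMul_zero_propagation (hgen : IsGenerator (blockMatrix B₁ B₀ B₂ A₀ A₁ A₂))
    {u : ℕ → Fin m → ℝ} {n : ℕ} (hu : ∀ k ≤ n + 1, 0 ≤ u k)
    {j : Fin m} (huj : u n j = 0) :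
    0 ≤ leftMul A₀ A₁ A₂ u n j ∧ (leftMul A₀ A₁ A₂ u n j ≤ 0 → ∀ l i,
      0 < blockMatrix B₁ B₀ B₂ A₀ A₁ A₂ (Sum.inr (l, i)) (Sum.inr (n, j)) → u l i = 0) := by
  cases n with
  | zero =>
    have hT : ∀ i, i ≠ j → 0 ≤ (A₀ + A₁) i j := fun i hi =>
      add_nonneg (hgen.A₀_nonneg i j) (hgen.A₁_nonneg hi)
    have h1 := vecMul_apply_nonneg_of_eq_zero (hu 0 (by omega)) huj hT
    have h2 := vecMul_nonneg (hu 1 (by omega)) hgen.A₂_nonneg j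
    simp only [leftMul, Pi.add_apply, Pi.zero_apply] at h1 h2 ⊢
    refine ⟨add_nonneg h1 h2, fun hle l i hli => ?_⟩
    rcases blockMatrix_inr_pos hli with ⟨c1, hpos⟩ | ⟨rfl, hpos⟩ | ⟨rfl, hpos⟩
    · omega
    · refine eq_zero_of_vecMul_apply_nonpos (hu 0 (by omega)) huj hT (by linarith) (i := i) ?_
      exact add_pos_of_nonneg_of_pos (hgen.A₀_nonneg i j) hpos
    · exact eq_zero_of_vecMul_apply_nonpos_of_nonneg (hu _ (by omega)) hgen.A₂_nonneg
        (by linarith) hpos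
  | succ n =>
    have hT : ∀ i, i ≠ j → 0 ≤ A₁ i j := fun i hi => hgen.A₁_nonneg hi
    have h0 := vecMul_nonneg (hu n (by omega)) hgen.A₀_nonneg j
    have h1 := vecMul_apply_nonneg_of_eq_zero (hu (n + 1) (by omega)) huj hT
    have h2 := vecMul_nonneg (hu (n + 2) (by omega)) hgen.A₂_nonneg j
    simp only [leftMul, Pi.add_apply, Pi.zero_apply] at h0 h1 h2 ⊢
    refine ⟨by linarith, fun hle l i hli => ?_⟩
    rcases blockMatrix_inr_pos hli with ⟨c1, hpos⟩ | ⟨rfl, hpos⟩ | ⟨rfl, hpos⟩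
    · obtain rfl : n = l := by omega
      exact eq_zero_of_vecMul_apply_nonpos_of_nonneg (hu _ (by omega)) hgen.A₀_nonneg
        (by linarith) hpos
    · exact eq_zero_of_vecMul_apply_nonpos (hu _ (by omega)) huj hT (by linarith) hpos
    · exact eq_zero_of_vecMul_apply_nonpos_of_nonneg (hu _ (by omega)) hgen.A₂_nonneg
        (by linarith) hpos

/-- The minimum principle on the levels up to `K`. -/
theorem nonneg_of_leftMul_nonpos (hgen : IsGenerator (blockMatrix B₁ B₀ B₂ A₀ A₁ A₂))
    (hirr : IsIrreducible (blockMatrix B₁ B₀ B₂ A₀ A₁ A₂))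
    (hx : IsStationary (blockMatrix B₁ B₀ B₂ A₀ A₁ A₂) x) {K : ℕ} {z : ℕ → Fin m → ℝ}
    (hz : ∀ n ≤ K, leftMul A₀ A₁ A₂ z n ≤ 0) (hK : 0 ≤ z (K + 1)) : ∀ n ≤ K, 0 ≤ z n := by
  by_contra! hcon
  obtain ⟨n₀, hn₀, hneg⟩ := hcon
  obtain ⟨i₀, hi₀⟩ : ∃ i, z n₀ i < 0 := by
    by_contra! h
    exact hneg h
  set p : ℕ → Fin m → ℝ := fun k => tail x (k + 1) with hp
  have hpos : ∀ n i, 0 < p n i := fun n i => hx.tail_pos hgen hirr n i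
  -- The maximal ratio `c` is the least multiple of `p` that makes `z + c • p` nonnegative up to
  -- level `K`; it touches zero at `(n₁, i₁)`.
  obtain ⟨⟨n₁, i₁⟩, hmem, hmax⟩ := Finset.exists_max_image
    (Finset.range (K + 1) ×ˢ (Finset.univ : Finset (Fin m)))
    (fun a => -z a.1 a.2 / p a.1 a.2) ⟨(n₀, i₀), by simp; omega⟩
  set c : ℝ := -z n₁ i₁ / p n₁ i₁ with hc
  have hn₁ : n₁ ≤ K := by simp at hmem; omega
  have hcpos : 0 < c := lt_of_lt_of_le (div_pos (neg_pos.2 hi₀) (hpos n₀ i₀))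
    (hmax (n₀, i₀) (by simp; omega))
  set u : ℕ → Fin m → ℝ := z + c • p with hu
  have hu_le : ∀ k ≤ K, 0 ≤ u k := fun k hk i => by
    have h := hmax (k, i) (by simp; omega)
    have h' := (div_le_iff₀ (hpos k i)).1 h
    simp only [hu, Pi.add_apply, Pi.smul_apply, smul_eq_mul, Pi.zero_apply]
    linarith
  have hu_top : ∀ i, 0 < u (K + 1) i := fun i =>
    add_pos_of_nonneg_of_pos (hK i) (mul_pos hcpos (hpos _ _))
  have hu_nonneg : ∀ k ≤ K + 1, 0 ≤ u k := fun k hk => by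
    rcases Nat.lt_or_ge K k with h | h
    · obtain rfl : k = K + 1 := by omega
      exact fun i => (hu_top i).le
    · exact hu_le k h
  have hu_mul : ∀ n ≤ K, leftMul A₀ A₁ A₂ u n ≤ c • leftMul A₀ A₁ A₂ p n := fun n hn => by
    rw [hu, leftMul_add, leftMul_smul]
    exact add_le_of_nonpos_left (hz n hn)
  have hu_mul_nonpos : ∀ n ≤ K, ∀ j, leftMul A₀ A₁ A₂ u n j ≤ 0 := fun n hn j =>
    (hu_mul n hn j).trans
      (mul_nonpos_of_nonneg_of_nonpos hcpos.le (leftMul_tail_le_zero hgen hx n j))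
  have hu₁ : u n₁ i₁ = 0 := by
    simp only [hu, hc, Pi.add_apply, Pi.smul_apply, smul_eq_mul]
    rw [div_mul_cancel₀ _ (hpos n₁ i₁).ne']
    ring
  -- Zeros of `u` spread backwards along paths into `(n₁, i₁)`, hence to every state. They can
  -- neither pass to `K + 1`, where `u > 0`, nor back to level `0`.
  have hall : ∀ a : State m₀ m, ∃ n i, a = Sum.inr (n, i) ∧ n ≤ K ∧ u n i = 0 := by
    intro a
    refine Relation.ReflTransGen.head_induction_on
      (motive := fun a _ => ∃ n i, a = Sum.inr (n, i) ∧ n ≤ K ∧ u n i = 0)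
      (hirr a (Sum.inr (n₁, i₁))) ⟨n₁, i₁, rfl, hn₁, hu₁⟩ ?_
    rintro b _ hbc _ ⟨n, j, rfl, hn, hnj⟩
    have hprop := leftMul_zero_propagation hgen (fun k hk => hu_nonneg k (by omega)) hnj
    rcases b with b | ⟨l, i⟩
    · exfalso
      have hB := hbc.2
      simp only [blockMatrix] at hB
      split_ifs at hB with hn0
      -- A jump from level `0` makes the source term `-x₀B₀` strictly negative at a zero of `u`,
      -- where the product must be nonnegative.
      · subst hn0
        have h1 := hu_mul 0 hn j
        rw [hp, hx.leftMul_tail_zero] at h1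
        have h2 := mul_pos hcpos (hx.entry_pos hgen hirr hB)
        simp only [Pi.smul_apply, Pi.neg_apply, smul_eq_mul] at h1
        linarith [hprop.1]
      · exact absurd hB (lt_irrefl _)
    · have hli := hprop.2 (hu_mul_nonpos n hn j) l i hbc.2
      refine ⟨l, i, rfl, ?_, hli⟩
      by_contra hlK
      rcases blockMatrix_inr_pos hbc.2 with ⟨h, -⟩ | ⟨h, -⟩ | ⟨h, -⟩
      · omega
      · omega
      · obtain rfl : l = K + 1 := by omega
        exact absurd hli (hu_top i).ne'
  obtain ⟨n, i, h, hn, -⟩ := hall (Sum.inr (K + 1, i₁))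
  simp only [Sum.inr.injEq, Prod.mk.injEq] at h
  omega

/-- A solution of the homogeneous system which tends to zero vanishes. -/
theorem eq_zero_of_leftMul_eq_zero (hgen : IsGenerator (blockMatrix B₁ B₀ B₂ A₀ A₁ A₂))
    (hirr : IsIrreducible (blockMatrix B₁ B₀ B₂ A₀ A₁ A₂)) {h : ℕ → Fin m → ℝ}
    (hh : ∀ n, leftMul A₀ A₁ A₂ h n = 0) (hlim : Tendsto h atTop (𝓝 0)) : h = 0 := by
  -- Differencing removes the extra `A₀` in the corner: `y` is annihilated by the generator
  -- restricted to the levels above `0`, whose row sums lose `A₂ *ᵥ 1` at the lowest level.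
  set y : ℕ → Fin m → ℝ := fun n => h n - h (n + 1) with hy
  set a : ℕ → Fin m → ℝ := fun n i => |y n i| with ha
  have ha0 : ∀ n, 0 ≤ a n := fun n i => abs_nonneg _
  have hylim : Tendsto y atTop (𝓝 0) := by
    simpa using hlim.sub ((tendsto_add_atTop_iff_nat 1).2 hlim)
  have halim : Tendsto a atTop (𝓝 0) := by
    rw [tendsto_pi_nhds] at hylim ⊢
    intro i
    simpa using (hylim i).abs
  have hy0 : y 0 ᵥ* A₁ + y 1 ᵥ* A₂ = 0 := by
    have e0 := hh 0
    have e1 := hh 1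
    simp only [leftMul, Matrix.vecMul_add, hy, Matrix.sub_vecMul] at e0 e1 ⊢
    linear_combination e0 - e1
  have hyS : ∀ n, y n ᵥ* A₀ + y (n + 1) ᵥ* A₁ + y (n + 2) ᵥ* A₂ = 0 := fun n => by
    have e0 := hh (n + 1)
    have e1 := hh (n + 2)
    simp only [leftMul, hy, Matrix.sub_vecMul] at e0 e1 ⊢
    linear_combination e0 - e1
  -- comparison of `|y|` with `y` up to a sign
  have hcmp : ∀ (T : Matrix (Fin m) (Fin m) ℝ) (n k : ℕ) (j : Fin m) (s : ℝ), |s| = 1 →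
      (∀ i, (n = k ∧ i = j) ∨ 0 ≤ T i j) → s * y k j = a k j →
      s * (y n ᵥ* T) j ≤ (a n ᵥ* T) j := by
    intro T n k j s hs hT hsj
    simp only [Matrix.vecMul, dotProduct, Finset.mul_sum]
    refine Finset.sum_le_sum fun i _ => ?_
    rw [← mul_assoc]
    rcases hT i with ⟨rfl, rfl⟩ | hT
    · rw [hsj]
    · refine mul_le_mul_of_nonneg_right ?_ hT
      calc s * y n i ≤ |s * y n i| := le_abs_self _
        _ = a n i := by rw [abs_mul, hs, one_mul]
  have hsign : ∀ n j, ∃ s : ℝ, |s| = 1 ∧ s * y n j = a n j := fun n j => by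
    rcases abs_cases (y n j) with ⟨e, -⟩ | ⟨e, -⟩
    · exact ⟨1, by simp, by simp [ha, e]⟩
    · exact ⟨-1, by simp, by simp [ha, e]⟩
  -- `F` is the product of `|y|` with that restricted generator. Only diagonal entries can be
  -- negative, so `F ≥ 0` follows from the equations for `y`.
  set F : ℕ → Fin m → ℝ := fun n => Nat.casesOn n (a 0 ᵥ* A₁ + a 1 ᵥ* A₂)
    (fun n => a n ᵥ* A₀ + a (n + 1) ᵥ* A₁ + a (n + 2) ᵥ* A₂) with hF
  have hF0 : F 0 = a 0 ᵥ* A₁ + a 1 ᵥ* A₂ := rfl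
  have hFS : ∀ n, F (n + 1) = a n ᵥ* A₀ + a (n + 1) ᵥ* A₁ + a (n + 2) ᵥ* A₂ := fun _ => rfl
  have hA₁ : ∀ (n : ℕ) (j i : Fin m), (n = n ∧ i = j) ∨ 0 ≤ A₁ i j := fun n j i => by
    by_cases hij : i = j
    · exact Or.inl ⟨rfl, hij⟩
    · exact Or.inr (hgen.A₁_nonneg hij)
  have hFnonneg : ∀ n, 0 ≤ F n := by
    rintro (_ | n) j
    · obtain ⟨s, hs, hsj⟩ := hsign 0 j
      have e := congrFun hy0 j
      have e1 := hcmp A₁ 0 0 j s hs (hA₁ 0 j) hsj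
      have e2 := hcmp A₂ 1 0 j s hs (fun i => Or.inr (hgen.A₂_nonneg i j)) hsj
      simp only [hF0, Pi.add_apply, Pi.zero_apply] at e ⊢
      have : s * ((y 0 ᵥ* A₁) j + (y 1 ᵥ* A₂) j) = 0 := by rw [e, mul_zero]
      linarith
    · obtain ⟨s, hs, hsj⟩ := hsign (n + 1) j
      have e := congrFun (hyS n) j
      have e0 := hcmp A₀ n (n + 1) j s hs (fun i => Or.inr (hgen.A₀_nonneg i j)) hsj
      have e1 := hcmp A₁ (n + 1) (n + 1) j s hs (hA₁ (n + 1) j) hsj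
      have e2 := hcmp A₂ (n + 2) (n + 1) j s hs (fun i => Or.inr (hgen.A₂_nonneg i j)) hsj
      simp only [hFS, Pi.add_apply, Pi.zero_apply] at e ⊢
      have : s * ((y n ᵥ* A₀) j + (y (n + 1) ᵥ* A₁) j + (y (n + 2) ᵥ* A₂) j) = 0 := by
        rw [e, mul_zero]
      linarith
  -- By the zero row sums the total mass of `F` telescopes. As `a → 0`, this forces both `F` and the
  -- exit flow `a 0 ⬝ᵥ A₂ *ᵥ 1` to vanish.
  have htel : ∀ N, ∑ n ∈ Finset.range (N + 1), F n ⬝ᵥ 1 =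
      -(a 0 ⬝ᵥ A₂ *ᵥ 1) - a N ⬝ᵥ A₀ *ᵥ 1 + a (N + 1) ⬝ᵥ A₂ *ᵥ 1 := fun N => by
    induction N with
    | zero =>
      simp only [zero_add, Finset.sum_range_one, hF0, add_dotProduct, ← Matrix.dotProduct_mulVec,
        hgen.A₁_mulVec_one, dotProduct_sub, dotProduct_neg]
      ring
    | succ N ih =>
      rw [Finset.sum_range_succ, ih]
      simp only [hFS, add_dotProduct, ← Matrix.dotProduct_mulVec,
        hgen.A₁_mulVec_one, dotProduct_sub, dotProduct_neg]
      ring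
  have hA₂1 : ∀ i, 0 ≤ (A₂ *ᵥ 1) i := fun i => by
    rw [Matrix.mulVec, dotProduct_one]; exact Finset.sum_nonneg fun j _ => hgen.A₂_nonneg i j
  have hA₀1 : ∀ i, 0 ≤ (A₀ *ᵥ 1) i := fun i => by
    rw [Matrix.mulVec, dotProduct_one]; exact Finset.sum_nonneg fun j _ => hgen.A₀_nonneg i j
  have hdot : ∀ (n : ℕ) (v : Fin m → ℝ), (∀ i, 0 ≤ v i) → 0 ≤ a n ⬝ᵥ v := fun n v hv =>
    Finset.sum_nonneg fun i _ => mul_nonneg (ha0 n i) (hv i)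
  have hF1 : ∀ n, 0 ≤ F n ⬝ᵥ 1 := fun n =>
    Finset.sum_nonneg fun i _ => mul_nonneg (hFnonneg n i) zero_le_one
  have hbound : ∀ n, F n ⬝ᵥ 1 + a 0 ⬝ᵥ A₂ *ᵥ 1 ≤ 0 := fun n => by
    have hl : Tendsto (fun N => a (N + 1) ⬝ᵥ A₂ *ᵥ 1) atTop (𝓝 0) := by
      have hc : Continuous fun v : Fin m → ℝ => v ⬝ᵥ A₂ *ᵥ 1 :=
        Continuous.dotProduct continuous_id continuous_const
      simpa [Function.comp_def] using (hc.tendsto 0).comp ((tendsto_add_atTop_iff_nat 1).2 halim)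
    refine ge_of_tendsto hl (eventually_atTop.2 ⟨n, fun N hN => ?_⟩)
    have h1 := Finset.single_le_sum (f := fun n => F n ⬝ᵥ 1) (fun k _ => hF1 k)
      (Finset.mem_range.2 (show n < N + 1 by omega))
    rw [htel] at h1
    linarith [hdot N _ hA₀1]
  have hFzero : ∀ n j, F n j = 0 := fun n j => by
    have h1 : ∑ j, F n j = 0 := by
      have := hbound n
      have h2 := hdot 0 _ hA₂1
      have h3 := hF1 n
      have h4 : F n ⬝ᵥ 1 = ∑ j, F n j := by simp [dotProduct]
      linarith
    exact (Finset.sum_eq_zero_iff_of_nonneg fun j _ => hFnonneg n j).1 h1 j (Finset.mem_univ j)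
  have hexit : ∀ i, 0 < (A₂ *ᵥ 1) i → a 0 i = 0 := fun i hi => by
    have h1 : a 0 ⬝ᵥ A₂ *ᵥ 1 = 0 :=
      le_antisymm (by linarith [hbound 0, hF1 0]) (hdot 0 _ hA₂1)
    have h2 := (Finset.sum_eq_zero_iff_of_nonneg
      fun i _ => mul_nonneg (ha0 0 i) (hA₂1 i)).1 h1 i (Finset.mem_univ i)
    exact (mul_eq_zero.1 h2).resolve_right hi.ne'
  -- Every state has a path to level `0`. At the last state before entering it `a` vanishes by
  -- `hexit`, and `F = 0` carries the zero back along the path.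
  have hzero : ∀ n i, a n i = 0 := fun n i => by
    obtain ⟨i₀⟩ := nonempty_level₀ hgen hirr i
    suffices H : ∀ b : State m₀ m, ∀ n i, b = Sum.inr (n, i) → a n i = 0 from H _ n i rfl
    intro b
    refine Relation.ReflTransGen.head_induction_on
      (motive := fun b _ => ∀ n i, b = Sum.inr (n, i) → a n i = 0)
      (hirr b (Sum.inl i₀)) (fun n i h => by simp at h) ?_
    rintro _ c hbc _ ih n i rfl
    rcases c with c | ⟨l, j⟩
    · have hB := hbc.2
      simp only [blockMatrix] at hB
      split_ifs at hB with hn0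
      · subst hn0
        refine hexit i ?_
        rw [Matrix.mulVec, dotProduct_one, ← hgen.sum_B₂_eq_sum_A₂]
        exact Finset.sum_pos' (fun k _ => hgen.B₂_nonneg i k) ⟨c, Finset.mem_univ c, hB⟩
      · exact absurd hB (lt_irrefl _)
    · have hlj := ih l j rfl
      have hT : ∀ i, i ≠ j → 0 ≤ A₁ i j := fun i hi => hgen.A₁_nonneg hi
      have g1 := vecMul_apply_nonneg_of_eq_zero (ha0 l) hlj hT
      have g2 := vecMul_nonneg (ha0 (l + 1)) hgen.A₂_nonneg j
      have hFl := hFzero l j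
      simp only [Pi.zero_apply] at g2
      rcases l with _ | l
      · simp only [hF0, Pi.add_apply] at hFl
        rcases blockMatrix_inr_pos hbc.2 with ⟨c1, hB⟩ | ⟨rfl, hB⟩ | ⟨rfl, hB⟩
        · omega
        · exact eq_zero_of_vecMul_apply_nonpos (ha0 _) hlj hT (by linarith) hB
        · exact eq_zero_of_vecMul_apply_nonpos_of_nonneg (ha0 _) hgen.A₂_nonneg
            (by linarith) hB
      · have g0 := vecMul_nonneg (ha0 l) hgen.A₀_nonneg j
        simp only [Pi.zero_apply] at g0
        simp only [hFS, Pi.add_apply] at hFl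
        rcases blockMatrix_inr_pos hbc.2 with ⟨c1, hB⟩ | ⟨rfl, hB⟩ | ⟨rfl, hB⟩
        · obtain rfl : l = n := by omega
          exact eq_zero_of_vecMul_apply_nonpos_of_nonneg (ha0 _) hgen.A₀_nonneg
            (by linarith) hB
        · exact eq_zero_of_vecMul_apply_nonpos (ha0 _) hlj hT (by linarith) hB
        · exact eq_zero_of_vecMul_apply_nonpos_of_nonneg (ha0 _) hgen.A₂_nonneg
            (by linarith) hB
  have hconst : ∀ n, h n = h 0 := fun n => by
    induction n with
    | zero => rfl
    | succ n ih =>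
      rw [← ih]
      funext i
      have := abs_eq_zero.1 (hzero n i)
      simp only [hy, Pi.sub_apply] at this
      linarith
  have h0 : h 0 = 0 := tendsto_nhds_unique (tendsto_const_nhds (x := h 0))
    (hlim.congr hconst)
  funext n
  rw [hconst n, h0]
  rfl

end LeftMul

/-! ### Block elimination and back substitution -/

section Factorization

variable {m : ℕ} {A₀ A₁ A₂ : Matrix (Fin m) (Fin m) ℝ}

theorem Y_succ (n : ℕ) : Y A₀ A₁ A₂ 0 (n + 1) = Y A₀ A₁ A₂ 0 n * G A₀ A₁ A₂ n := by
  simp [Y, List.range_succ]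

theorem X_zero_right (l : ℕ) : X A₀ A₁ A₂ l 0 = 1 := by simp [X]

theorem X_succ (l k : ℕ) : X A₀ A₁ A₂ l (k + 1) = X A₀ A₁ A₂ l k * R A₀ A₁ A₂ (l - k) := by
  simp [X, List.range_succ]

theorem Psi_succ (k : ℕ) : Psi A₀ A₁ A₂ (k + 1) = A₁ + R A₀ A₁ A₂ (k + 1) * A₀ := rfl

theorem R_succ_mul_Psi {k : ℕ} (hU : IsUnit (Psi A₀ A₁ A₂ k)) :
    R A₀ A₁ A₂ (k + 1) * Psi A₀ A₁ A₂ k = -A₂ := by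
  have hdet := (Matrix.isUnit_iff_isUnit_det _).1 hU
  simp only [R, Matrix.mul_assoc, Matrix.neg_mul, Matrix.nonsing_inv_mul _ hdet, Matrix.mul_neg,
    Matrix.mul_one]

/-- The relation `z_n = s Y_n (-Ψ_n⁻¹) + z_{n+1} R_{n+1}`, satisfied by the solutions of the
linear system with right hand side `-s` at the lowest level. -/
def BackwardRec (A₀ A₁ A₂ : Matrix (Fin m) (Fin m) ℝ) (s : Fin m → ℝ) (z : ℕ → Fin m → ℝ)
    (n : ℕ) : Prop :=
  z n = s ᵥ* (Y A₀ A₁ A₂ 0 n * (-(Psi A₀ A₁ A₂ n)⁻¹)) + z (n + 1) ᵥ* R A₀ A₁ A₂ (n + 1)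

variable {s : Fin m → ℝ} {z : ℕ → Fin m → ℝ}

theorem BackwardRec.vecMul_Psi {n : ℕ} (hU : IsUnit (Psi A₀ A₁ A₂ n))
    (h : BackwardRec A₀ A₁ A₂ s z n) :
    z n ᵥ* Psi A₀ A₁ A₂ n = -(s ᵥ* Y A₀ A₁ A₂ 0 n) - z (n + 1) ᵥ* A₂ := by
  have hdet := (Matrix.isUnit_iff_isUnit_det _).1 hU
  rw [h, Matrix.add_vecMul, Matrix.vecMul_vecMul, Matrix.vecMul_vecMul, R_succ_mul_Psi hU,
    Matrix.mul_assoc, Matrix.neg_mul, Matrix.nonsing_inv_mul _ hdet, Matrix.mul_neg,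
    Matrix.mul_one, Matrix.vecMul_neg, Matrix.vecMul_neg, sub_eq_add_neg]

/-- One elimination step: substituting the recursion for `z n` turns the pivot `A₁` into `Ψ_{n+1}`
and the source into `s Y_{n+1}`. -/
theorem BackwardRec.leftMul_succ {n : ℕ} (h : BackwardRec A₀ A₁ A₂ s z n) :
    leftMul A₀ A₁ A₂ z (n + 1) = z (n + 1) ᵥ* Psi A₀ A₁ A₂ (n + 1) +
      s ᵥ* Y A₀ A₁ A₂ 0 (n + 1) + z (n + 2) ᵥ* A₂ := by
  have h' := congrArg (· ᵥ* A₀) h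
  simp only [Matrix.add_vecMul, Matrix.vecMul_vecMul] at h'
  rw [leftMul, h', Psi_succ, Y_succ, G, Matrix.vecMul_add, Matrix.mul_assoc]
  abel

theorem leftMul_zero_eq :
    leftMul A₀ A₁ A₂ z 0 = z 0 ᵥ* Psi A₀ A₁ A₂ 0 + z 1 ᵥ* A₂ := rfl

theorem leftMul_zero_of_backwardRec (hU : IsUnit (Psi A₀ A₁ A₂ 0))
    (h : BackwardRec A₀ A₁ A₂ s z 0) : leftMul A₀ A₁ A₂ z 0 = -s := by
  rw [leftMul_zero_eq, h.vecMul_Psi hU]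
  simp [Y]

theorem leftMul_succ_of_backwardRec {n : ℕ} (hU : IsUnit (Psi A₀ A₁ A₂ (n + 1)))
    (h : BackwardRec A₀ A₁ A₂ s z n) (h' : BackwardRec A₀ A₁ A₂ s z (n + 1)) :
    leftMul A₀ A₁ A₂ z (n + 1) = 0 := by
  rw [h.leftMul_succ, h'.vecMul_Psi hU]
  abel

/-- The summand `Y_{n+k} (-Ψ_{n+k}⁻¹) X_k^{(n+k)}` of the series for the levels above `n`. -/
noncomputable def seriesTerm (A₀ A₁ A₂ : Matrix (Fin m) (Fin m) ℝ) (n k : ℕ) :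
    Matrix (Fin m) (Fin m) ℝ :=
  Y A₀ A₁ A₂ 0 (n + k) * (-(Psi A₀ A₁ A₂ (n + k))⁻¹) * X A₀ A₁ A₂ (n + k) k

theorem seriesTerm_zero (n : ℕ) :
    seriesTerm A₀ A₁ A₂ n 0 = Y A₀ A₁ A₂ 0 n * (-(Psi A₀ A₁ A₂ n)⁻¹) := by
  rw [seriesTerm, X_zero_right, Matrix.mul_one, add_zero]

/-- The last factor of `X_{k+1}^{(n+k+1)}` is `R_{n+1}` for every `k`; factoring it out yields the
backward recursion for the sums. -/
theorem seriesTerm_succ (n k : ℕ) :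
    seriesTerm A₀ A₁ A₂ n (k + 1) = seriesTerm A₀ A₁ A₂ (n + 1) k * R A₀ A₁ A₂ (n + 1) := by
  rw [seriesTerm, X_succ, seriesTerm, show n + (k + 1) - k = n + 1 by omega,
    show n + (k + 1) = n + 1 + k by omega, ← Matrix.mul_assoc]

theorem sum_seriesTerm_succ (n J : ℕ) :
    ∑ k ∈ Finset.range (J + 1), seriesTerm A₀ A₁ A₂ n k =
      Y A₀ A₁ A₂ 0 n * (-(Psi A₀ A₁ A₂ n)⁻¹) +
        (∑ k ∈ Finset.range J, seriesTerm A₀ A₁ A₂ (n + 1) k) * R A₀ A₁ A₂ (n + 1) := by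
  rw [Finset.sum_range_succ', seriesTerm_zero, Finset.sum_mul, add_comm]
  simp only [seriesTerm_succ]

/-- The partial sums of the series solve the system truncated above level `K`. -/
theorem backwardRec_sum (s : Fin m → ℝ) {K n : ℕ} (hn : n ≤ K) :
    BackwardRec A₀ A₁ A₂ s
      (fun n => s ᵥ* ∑ k ∈ Finset.range (K + 1 - n), seriesTerm A₀ A₁ A₂ n k) n := by
  simp only [BackwardRec]
  rw [show K + 1 - n = (K + 1 - (n + 1)) + 1 by omega, sum_seriesTerm_succ, Matrix.vecMul_add,
    Matrix.vecMul_vecMul]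

end Factorization

/-! ### Invertibility and sign of the pivots -/

section Main

variable {m₀ m : ℕ} {B₁ : Matrix (Fin m₀) (Fin m₀) ℝ} {B₀ : Matrix (Fin m₀) (Fin m) ℝ}
  {B₂ : Matrix (Fin m) (Fin m₀) ℝ} {A₀ A₁ A₂ : Matrix (Fin m) (Fin m) ℝ}
  {x : State m₀ m → ℝ}

theorem nonneg_of_vecMul_Psi_nonpos (hgen : IsGenerator (blockMatrix B₁ B₀ B₂ A₀ A₁ A₂))
    (hirr : IsIrreducible (blockMatrix B₁ B₀ B₂ A₀ A₁ A₂))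
    (hx : IsStationary (blockMatrix B₁ B₀ B₂ A₀ A₁ A₂) x) {K : ℕ}
    (hU : ∀ n < K, IsUnit (Psi A₀ A₁ A₂ n)) {w : Fin m → ℝ}
    (hw : w ᵥ* Psi A₀ A₁ A₂ K ≤ 0) : 0 ≤ w := by
  -- Continuing `w` downwards by the `R_k` annihilates the components below `K` and leaves `w ᵥ*
  -- Ψ_K` at `K`, so the minimum principle applies.
  set z : ℕ → Fin m → ℝ := fun n => if n ≤ K then w ᵥ* X A₀ A₁ A₂ K (K - n) else 0 with hz
  have hzK : z K = w := by simp [hz, X_zero_right]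
  have hzK1 : z (K + 1) = 0 := by simp [hz]
  have hrec : ∀ n < K, BackwardRec A₀ A₁ A₂ 0 z n := fun n hn => by
    simp only [BackwardRec, hz, Matrix.zero_vecMul, zero_add]
    rw [if_pos hn.le, if_pos (by omega), show K - n = (K - (n + 1)) + 1 by omega, X_succ,
      show K - (K - (n + 1)) = n + 1 by omega, Matrix.vecMul_vecMul]
  have hle : ∀ n ≤ K, leftMul A₀ A₁ A₂ z n ≤ 0 := fun n hn => by
    rcases hn.lt_or_eq with hlt | rfl
    · refine le_of_eq ?_
      cases n with
      | zero => rw [leftMul_zero_of_backwardRec (hU 0 hlt) (hrec 0 hlt), neg_zero]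
      | succ n => exact leftMul_succ_of_backwardRec (hU _ hlt) (hrec n (by omega)) (hrec _ hlt)
    · cases n with
      | zero => rwa [leftMul_zero_eq, hzK, hzK1, Matrix.zero_vecMul, add_zero]
      | succ n =>
        rwa [(hrec n (by omega)).leftMul_succ, hzK, hzK1, Matrix.zero_vecMul, Matrix.zero_vecMul,
          add_zero, add_zero]
  rw [← hzK]
  exact nonneg_of_leftMul_nonpos hgen hirr hx hle hzK1.ge K le_rfl

theorem isUnit_Psi (hgen : IsGenerator (blockMatrix B₁ B₀ B₂ A₀ A₁ A₂))
    (hirr : IsIrreducible (blockMatrix B₁ B₀ B₂ A₀ A₁ A₂))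
    (hx : IsStationary (blockMatrix B₁ B₀ B₂ A₀ A₁ A₂) x) (K : ℕ) :
    IsUnit (Psi A₀ A₁ A₂ K) := by
  induction K using Nat.strong_induction_on with
  | _ K ih =>
    rw [← Matrix.vecMul_injective_iff_isUnit]
    intro v w hvw
    have hvw' : (v - w) ᵥ* Psi A₀ A₁ A₂ K = 0 := by
      rw [Matrix.sub_vecMul]; exact sub_eq_zero.2 hvw
    have h1 := nonneg_of_vecMul_Psi_nonpos hgen hirr hx ih hvw'.le
    have h2 := nonneg_of_vecMul_Psi_nonpos hgen hirr hx ih (w := -(v - w))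
      (by rw [Matrix.neg_vecMul, hvw', neg_zero])
    exact sub_eq_zero.1 (le_antisymm (neg_nonneg.1 h2) h1)

/-- Each row `w` of `-Ψ_K⁻¹` satisfies `w ᵥ* Ψ_K = -e_i ≤ 0`. -/
theorem neg_inv_Psi_nonneg (hgen : IsGenerator (blockMatrix B₁ B₀ B₂ A₀ A₁ A₂))
    (hirr : IsIrreducible (blockMatrix B₁ B₀ B₂ A₀ A₁ A₂))
    (hx : IsStationary (blockMatrix B₁ B₀ B₂ A₀ A₁ A₂) x) (K : ℕ) (i j : Fin m) :
    0 ≤ (-(Psi A₀ A₁ A₂ K)⁻¹) i j := by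
  have hdet := (Matrix.isUnit_iff_isUnit_det _).1 (isUnit_Psi hgen hirr hx K)
  have h := nonneg_of_vecMul_Psi_nonpos hgen hirr hx (K := K)
    (fun n _ => isUnit_Psi hgen hirr hx n) (w := Pi.single i 1 ᵥ* (-(Psi A₀ A₁ A₂ K)⁻¹)) (by
      rw [Matrix.vecMul_vecMul, Matrix.neg_mul, Matrix.nonsing_inv_mul _ hdet, Matrix.vecMul_neg,
        Matrix.vecMul_one]
      exact neg_nonpos.2 (Pi.single_nonneg.2 zero_le_one)) j
  rwa [Matrix.single_one_vecMul] at h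

/-! ### Convergence and identification of the series -/

theorem seriesTerm_nonneg (hgen : IsGenerator (blockMatrix B₁ B₀ B₂ A₀ A₁ A₂))
    (hirr : IsIrreducible (blockMatrix B₁ B₀ B₂ A₀ A₁ A₂))
    (hx : IsStationary (blockMatrix B₁ B₀ B₂ A₀ A₁ A₂) x) (n k : ℕ) (i j : Fin m) :
    0 ≤ seriesTerm A₀ A₁ A₂ n k i j := by
  have hinv := neg_inv_Psi_nonneg hgen hirr hx
  refine mul_entries_nonneg (mul_entries_nonneg (list_prod_entries_nonneg ?_) (hinv _))
    (list_prod_entries_nonneg ?_) i j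
  · simp only [List.mem_map]
    rintro _ ⟨a, -, rfl⟩
    exact mul_entries_nonneg (hinv _) hgen.A₀_nonneg
  · simp only [List.mem_map]
    rintro _ ⟨a, -, rfl⟩
    -- The bound `a < k` has been dropped, so the dummy value `R 0 = 0` has to be covered.
    rcases n + k - a with _ | b
    · exact fun _ _ => le_rfl
    · exact mul_entries_nonneg hgen.A₂_nonneg (hinv _)

/-- The partial sums are dominated by any supersolution that is nonnegative at high levels. -/
theorem vecMul_sum_seriesTerm_le (hgen : IsGenerator (blockMatrix B₁ B₀ B₂ A₀ A₁ A₂))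
    (hirr : IsIrreducible (blockMatrix B₁ B₀ B₂ A₀ A₁ A₂))
    (hx : IsStationary (blockMatrix B₁ B₀ B₂ A₀ A₁ A₂) x) {s : Fin m → ℝ} (hs : 0 ≤ s)
    {q : ℕ → Fin m → ℝ} {N : ℕ} (hqN : ∀ n, N ≤ n → 0 ≤ q n)
    (hq0 : leftMul A₀ A₁ A₂ q 0 ≤ -s) (hq : ∀ n, leftMul A₀ A₁ A₂ q (n + 1) ≤ 0) (n J : ℕ) :
    s ᵥ* ∑ k ∈ Finset.range J, seriesTerm A₀ A₁ A₂ n k ≤ q n := by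
  -- `K` is large enough that `q ≥ 0` at `K + 1` and that the truncated sum at level `n` has at
  -- least `J` terms.
  set K := n + J + N with hK
  have hU := isUnit_Psi hgen hirr hx
  set z : ℕ → Fin m → ℝ :=
    fun n => s ᵥ* ∑ k ∈ Finset.range (K + 1 - n), seriesTerm A₀ A₁ A₂ n k with hz
  have hrec : ∀ n ≤ K, BackwardRec A₀ A₁ A₂ s z n := fun n hn => backwardRec_sum s hn
  have hzq : z n ≤ q n := by
    have h := nonneg_of_leftMul_nonpos hgen hirr hx (K := K) (z := q - z) (fun l hl => ?_) ?_ n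
      (by omega)
    · exact sub_nonneg.1 h
    · rw [leftMul_sub]
      cases l with
      | zero =>
        rw [leftMul_zero_of_backwardRec (hU 0) (hrec 0 hl), sub_nonpos]
        exact hq0
      | succ l =>
        rw [leftMul_succ_of_backwardRec (hU _) (hrec l (by omega)) (hrec _ hl), sub_zero]
        exact hq l
    · have : z (K + 1) = 0 := by simp [hz]
      rw [Pi.sub_apply, this, sub_zero]
      exact hqN _ (by omega)
  refine le_trans ?_ hzq
  rw [← sub_nonneg, hz, ← Matrix.vecMul_sub]
  refine vecMul_nonneg hs fun i j => ?_
  rw [Matrix.sub_apply, sub_nonneg, Matrix.sum_apply, Matrix.sum_apply]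
  exact Finset.sum_le_sum_of_subset_of_nonneg
    (Finset.range_subset_range.2 (by omega)) fun k _ _ => seriesTerm_nonneg hgen hirr hx n k i j

theorem single_vecMul_ite (l n : ℕ) (i j : Fin m) (T : Matrix (Fin m) (Fin m) ℝ) :
    ((if n = l then (Pi.single i 1 : Fin m → ℝ) else 0) ᵥ* T) j = if n = l then T i j else 0 := by
  split_ifs <;> simp

/-- Every state above level `0` carries a supersolution that is strict there. -/
theorem exists_supersolution (hgen : IsGenerator (blockMatrix B₁ B₀ B₂ A₀ A₁ A₂))
    (hirr : IsIrreducible (blockMatrix B₁ B₀ B₂ A₀ A₁ A₂))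
    (hx : IsStationary (blockMatrix B₁ B₀ B₂ A₀ A₁ A₂) x) (n : ℕ) (j : Fin m) :
    ∃ q : ℕ → Fin m → ℝ, (∃ N, ∀ n, N ≤ n → 0 ≤ q n) ∧ (∀ n, leftMul A₀ A₁ A₂ q n ≤ 0) ∧
      leftMul A₀ A₁ A₂ q n j < 0 := by
  obtain ⟨i₀⟩ := nonempty_level₀ hgen hirr j
  suffices H : ∀ b : State m₀ m, ∀ n j, b = Sum.inr (n, j) → ∃ q : ℕ → Fin m → ℝ,
      (∃ N, ∀ n, N ≤ n → 0 ≤ q n) ∧ (∀ n, leftMul A₀ A₁ A₂ q n ≤ 0) ∧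
      leftMul A₀ A₁ A₂ q n j < 0 from H _ n j rfl
  intro b
  induction hirr (Sum.inl i₀) b with
  | refl => intro n j h; simp at h
  | @tail a c _ hac ih =>
    rintro n j rfl
    rcases a with a | ⟨l, i⟩
    · have hB := hac.2
      simp only [blockMatrix] at hB
      split_ifs at hB with hn0
      · subst hn0
        -- A state entered directly from level `0` has a positive entry in `x₀B₀`, so the tails
        -- themselves serve.
        refine ⟨fun k => tail x (k + 1), ⟨0, fun k _ i => (hx.tail_pos hgen hirr k i).le⟩,
          leftMul_tail_le_zero hgen hx, ?_⟩
        rw [hx.leftMul_tail_zero, Pi.neg_apply, neg_lt_zero]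
        exact hx.entry_pos hgen hirr hB
      · exact absurd hB (lt_irrefl _)
    · obtain ⟨q, ⟨N, hN⟩, hq, hqi⟩ := ih l i rfl
      -- Lowering `q` at `(l, i)` passes strictness to its successor `(n, j)`. The product can
      -- increase only at `(l, i)`, where there is room.
      set e : ℕ → Fin m → ℝ := fun k => if k = l then Pi.single i 1 else 0 with he
      have he_nonneg : ∀ n j, ¬(n = l ∧ j = i) → 0 ≤ leftMul A₀ A₁ A₂ e n j := by
        intro n j hnj
        have h0 := hgen.A₀_nonneg i j
        have h2 := hgen.A₂_nonneg i j
        cases n with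
        | zero =>
          simp only [leftMul, he, Pi.add_apply, single_vecMul_ite, Matrix.add_apply]
          refine add_nonneg ?_ (by split_ifs <;> simp [h2])
          split_ifs with h
          · exact add_nonneg h0 (hgen.A₁_nonneg fun hij => hnj ⟨h, hij.symm⟩)
          · exact le_rfl
        | succ n =>
          simp only [leftMul, he, Pi.add_apply, single_vecMul_ite]
          refine add_nonneg (add_nonneg (by split_ifs <;> simp [h0]) ?_)
            (by split_ifs <;> simp [h2])
          split_ifs with h
          · exact hgen.A₁_nonneg fun hij => hnj ⟨h, hij.symm⟩
          · exact le_rfl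
      have hne : ¬(n = l ∧ j = i) := fun h => hac.1 (by rw [h.1, h.2])
      have he_pos : 0 < leftMul A₀ A₁ A₂ e n j := by
        have h0 := hgen.A₀_nonneg i j
        rcases blockMatrix_inr_pos hac.2 with ⟨rfl, h⟩ | ⟨rfl, h⟩ | ⟨rfl, h⟩
        · simp [leftMul, he, h]
        · cases n with
          | zero => simp [leftMul, he]; linarith
          | succ n => simp [leftMul, he, h]
        · cases n with
          | zero => simp [leftMul, he, h]
          | succ n => simp [leftMul, he, h, show n ≠ n + 1 + 1 by omega]
      -- `δ` is chosen so that the increase at `(l, i)` is at most the slack there; the `+ 1` keeps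
      -- `C` positive.
      set C : ℝ := |leftMul A₀ A₁ A₂ e l i| + 1 with hC
      have hCpos : 0 < C := by positivity
      set δ : ℝ := -leftMul A₀ A₁ A₂ q l i / C with hδ
      have hδpos : 0 < δ := div_pos (neg_pos.2 hqi) hCpos
      have hδC : δ * C = -leftMul A₀ A₁ A₂ q l i := div_mul_cancel₀ _ hCpos.ne'
      refine ⟨q - δ • e, ⟨max N (l + 1), fun k hk => ?_⟩, fun k a => ?_, ?_⟩
      · have : e k = 0 := by
          have : k ≠ l := by have := le_of_max_le_right hk; omega
          simp [he, this]
        rw [Pi.sub_apply, Pi.smul_apply, this, smul_zero, sub_zero]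
        exact hN k (le_of_max_le_left hk)
      · rw [leftMul_sub, leftMul_smul]
        simp only [Pi.sub_apply, Pi.smul_apply, smul_eq_mul, Pi.zero_apply]
        by_cases hka : k = l ∧ a = i
        · obtain ⟨rfl, rfl⟩ := hka
          have h1 : -leftMul A₀ A₁ A₂ e k a ≤ C :=
            (neg_le_abs _).trans (by rw [hC]; linarith)
          nlinarith [mul_le_mul_of_nonneg_left h1 hδpos.le]
        · have h1 := hq k a
          have h2 := mul_nonneg hδpos.le (he_nonneg k a hka)
          simp only [Pi.zero_apply] at h1
          linarith
      · rw [leftMul_sub, leftMul_smul]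
        simp only [Pi.sub_apply, Pi.smul_apply, smul_eq_mul]
        have h1 := hq n j
        have h2 := mul_pos hδpos he_pos
        simp only [Pi.zero_apply] at h1
        linarith

theorem summable_seriesTerm (hgen : IsGenerator (blockMatrix B₁ B₀ B₂ A₀ A₁ A₂))
    (hirr : IsIrreducible (blockMatrix B₁ B₀ B₂ A₀ A₁ A₂))
    (hx : IsStationary (blockMatrix B₁ B₀ B₂ A₀ A₁ A₂) x) (n : ℕ) :
    Summable (seriesTerm A₀ A₁ A₂ n) := by
  refine Pi.summable.2 fun i => Pi.summable.2 fun j => ?_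
  obtain ⟨q, ⟨N, hN⟩, hq, hqi⟩ := exists_supersolution hgen hirr hx 0 i
  -- With source `c` times the `i`-th unit vector, `q` dominates `c` times row `i` of every partial
  -- sum.
  set c : ℝ := -leftMul A₀ A₁ A₂ q 0 i with hc
  have hcpos : 0 < c := neg_pos.2 hqi
  have hs : (0 : Fin m → ℝ) ≤ c • Pi.single i 1 :=
    smul_nonneg hcpos.le (Pi.single_nonneg.2 zero_le_one)
  refine summable_of_sum_range_le (c := c⁻¹ * q n j)
    (fun k => seriesTerm_nonneg hgen hirr hx n k i j) fun J => ?_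
  have h := vecMul_sum_seriesTerm_le hgen hirr hx hs hN (fun a => ?_) (fun k => hq (k + 1)) n J j
  · rw [Matrix.smul_vecMul, Matrix.single_one_vecMul] at h
    simp only [Pi.smul_apply, Matrix.row_apply, Matrix.sum_apply, smul_eq_mul] at h
    rwa [le_inv_mul_iff₀ hcpos]
  · by_cases hai : a = i
    · subst hai; simp [hc]
    · simpa [hai] using hq 0 a

theorem tail_eq_vecMul_tsum (hgen : IsGenerator (blockMatrix B₁ B₀ B₂ A₀ A₁ A₂))
    (hirr : IsIrreducible (blockMatrix B₁ B₀ B₂ A₀ A₁ A₂))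
    (hx : IsStationary (blockMatrix B₁ B₀ B₂ A₀ A₁ A₂) x) (n : ℕ) :
    tail x (n + 1) = (level₀ x ᵥ* B₀) ᵥ* ∑' k, seriesTerm A₀ A₁ A₂ n k := by
  set d := level₀ x ᵥ* B₀ with hd
  set p : ℕ → Fin m → ℝ := fun k => tail x (k + 1) with hp
  have hd0 : 0 ≤ d := hx.entry_nonneg hgen
  have hU := isUnit_Psi hgen hirr hx
  have hsum := summable_seriesTerm hgen hirr hx
  set v : ℕ → Fin m → ℝ := fun n => d ᵥ* ∑' k, seriesTerm A₀ A₁ A₂ n k with hv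
  have hvrec : ∀ n, BackwardRec A₀ A₁ A₂ d v n := fun n => by
    simp only [BackwardRec, hv]
    rw [(hsum n).tsum_eq_zero_add, seriesTerm_zero, Matrix.vecMul_add]
    simp only [seriesTerm_succ]
    rw [(hsum (n + 1)).tsum_mul_right, ← Matrix.vecMul_vecMul _ _ (R A₀ A₁ A₂ (n + 1))]
  have hvlim : ∀ n, Tendsto (fun J => d ᵥ* ∑ k ∈ Finset.range J, seriesTerm A₀ A₁ A₂ n k) atTop
      (𝓝 (v n)) := fun n => by
    have hc : Continuous fun T : Matrix (Fin m) (Fin m) ℝ => d ᵥ* T :=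
      Continuous.matrix_vecMul continuous_const continuous_id
    exact (hc.tendsto _).comp (hsum n).hasSum.tendsto_sum_nat
  have hvp : ∀ n, v n ≤ p n := fun n => le_of_tendsto' (hvlim n) fun J =>
    vecMul_sum_seriesTerm_le hgen hirr hx hd0 (N := 0)
      (fun k _ i => (hx.tail_pos hgen hirr k i).le) hx.leftMul_tail_zero.le
      (fun k => (hx.leftMul_tail_succ k).le) n J
  have hv0 : ∀ n, 0 ≤ v n := fun n => ge_of_tendsto' (hvlim n) fun J =>
    vecMul_nonneg hd0 fun i j => by
      rw [Matrix.sum_apply]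
      exact Finset.sum_nonneg fun k _ => seriesTerm_nonneg hgen hirr hx n k i j
  have hplim : Tendsto p atTop (𝓝 0) := (tendsto_add_atTop_iff_nat 1).2 (tendsto_tail x)
  -- Squeezing between `0` and the tails gives the decay that uniqueness requires.
  have hv_lim : Tendsto v atTop (𝓝 0) := by
    rw [tendsto_pi_nhds] at hplim ⊢
    exact fun i => squeeze_zero (fun n => hv0 n i) (fun n => hvp n i) (hplim i)
  have hzero : p - v = 0 := by
    refine eq_zero_of_leftMul_eq_zero hgen hirr (fun n => ?_) ?_
    swap
    · have h := hplim.sub hv_lim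
      rwa [sub_zero] at h
    rw [leftMul_sub]
    cases n with
    | zero =>
      rw [hx.leftMul_tail_zero, leftMul_zero_of_backwardRec (hU 0) (hvrec 0), sub_self]
    | succ n =>
      rw [hx.leftMul_tail_succ, leftMul_succ_of_backwardRec (hU _) (hvrec n) (hvrec _), sub_self]
  exact congrFun (sub_eq_zero.1 hzero) n

end Main

end QBD

open Matrix in
/-- In both series the summation index `k` of the formulas is `k = 1 + j`, respectively
`k = n + j` (so that `k - (n - 1) = j + 1`), with `j = 0, 1, 2, …`. -/
theorem mainTheorem2 {m₀ m : ℕ}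
    (B₁ : Matrix (Fin m₀) (Fin m₀) ℝ) (B₀ : Matrix (Fin m₀) (Fin m) ℝ)
    (B₂ : Matrix (Fin m) (Fin m₀) ℝ) (A₀ A₁ A₂ : Matrix (Fin m) (Fin m) ℝ)
    (hgen : QBD.IsGenerator (QBD.blockMatrix B₁ B₀ B₂ A₀ A₁ A₂))
    (hirr : QBD.IsIrreducible (QBD.blockMatrix B₁ B₀ B₂ A₀ A₁ A₂))
    (x : QBD.State m₀ m → ℝ)
    (hx : QBD.IsStationary (QBD.blockMatrix B₁ B₀ B₂ A₀ A₁ A₂) x) :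
    (∀ k, IsUnit (QBD.Psi A₀ A₁ A₂ k)) ∧
    (Summable (fun j : ℕ => QBD.Y A₀ A₁ A₂ 0 (1 + j) * (-(QBD.Psi A₀ A₁ A₂ (1 + j))⁻¹) *
          QBD.X A₀ A₁ A₂ (1 + j) (1 + j)) ∧
      QBD.tail x 1 = (QBD.level₀ x ᵥ* B₀) ᵥ*
        (-(QBD.Psi A₀ A₁ A₂ 0)⁻¹ + ∑' j : ℕ, QBD.Y A₀ A₁ A₂ 0 (1 + j) * (-(QBD.Psi A₀ A₁ A₂ (1 + j))⁻¹) *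
          QBD.X A₀ A₁ A₂ (1 + j) (1 + j))) ∧
    (∀ n : ℕ, 2 ≤ n →
      Summable (fun j : ℕ => QBD.Y A₀ A₁ A₂ 0 (n + j) * (-(QBD.Psi A₀ A₁ A₂ (n + j))⁻¹) *
          QBD.X A₀ A₁ A₂ (n + j) (j + 1)) ∧
      QBD.tail x n = (QBD.level₀ x ᵥ* B₀) ᵥ*
        (QBD.Y A₀ A₁ A₂ 0 (n - 1) * (-(QBD.Psi A₀ A₁ A₂ (n - 1))⁻¹) +
          ∑' j : ℕ, QBD.Y A₀ A₁ A₂ 0 (n + j) * (-(QBD.Psi A₀ A₁ A₂ (n + j))⁻¹) *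
          QBD.X A₀ A₁ A₂ (n + j) (j + 1))) := by
  have hsum := QBD.summable_seriesTerm hgen hirr hx
  have htail := QBD.tail_eq_vecMul_tsum hgen hirr hx
  have key : ∀ n, Summable (fun j : ℕ => QBD.Y A₀ A₁ A₂ 0 (n + 1 + j) *
        (-(QBD.Psi A₀ A₁ A₂ (n + 1 + j))⁻¹) * QBD.X A₀ A₁ A₂ (n + 1 + j) (j + 1)) ∧
      QBD.tail x (n + 1) = (QBD.level₀ x ᵥ* B₀) ᵥ*
        (QBD.Y A₀ A₁ A₂ 0 n * (-(QBD.Psi A₀ A₁ A₂ n)⁻¹) +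
          ∑' j : ℕ, QBD.Y A₀ A₁ A₂ 0 (n + 1 + j) * (-(QBD.Psi A₀ A₁ A₂ (n + 1 + j))⁻¹) *
          QBD.X A₀ A₁ A₂ (n + 1 + j) (j + 1)) := fun n => by
    have hterm : (fun j : ℕ => QBD.Y A₀ A₁ A₂ 0 (n + 1 + j) *
        (-(QBD.Psi A₀ A₁ A₂ (n + 1 + j))⁻¹) * QBD.X A₀ A₁ A₂ (n + 1 + j) (j + 1)) =
        fun j => QBD.seriesTerm A₀ A₁ A₂ n (j + 1) := by
      funext j
      rw [QBD.seriesTerm, show n + (j + 1) = n + 1 + j by omega]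
    rw [hterm, htail n, (hsum n).tsum_eq_zero_add, QBD.seriesTerm_zero]
    exact ⟨(summable_nat_add_iff 1).2 (hsum n), rfl⟩
  refine ⟨QBD.isUnit_Psi hgen hirr hx, ?_, fun n hn => ?_⟩
  · have h := key 0
    -- For `n = 1` the leading factor `Y_0` is the empty product.
    simp only [QBD.Y, List.range_zero, List.map_nil, List.prod_nil, Matrix.one_mul] at h ⊢
    simpa only [zero_add, add_comm] using h
  · obtain ⟨n, rfl⟩ : ∃ l, n = l + 1 := ⟨n - 1, by omega⟩
    exact key n
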